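/- Let $G\rightrightarrows M$ be a Lie groupoid with source $s$ and target $t$. A $G$-path from $x$ to $y$ is a sequence $\sigma=\sigma_n g_n\sigma_{n-1}\cdots\sigma_1 g_1\sigma_0$ of piecewise smooth paths $\sigma_j:[0,1]\to M$ and arrows $g_j:\sigma_{j-1}(1)\to\sigma_j(0)$ of $G$ with $\sigma_0(0)=x$ and $\sigma_n(1)=y$. Assume that $G$ is $G$-connected, that is, any two points of $M$ are joined by a $G$-path. Let $G$-homotopy be the equivalence relation on $G$-paths with fixed end points generated by - multiplication equivalence: $g_{j+1}\sigma_j g_j$ may be replaced by the product $g_{j+1}g_j$ if $0<j<n$ and $\sigma_j$ is constant; - concatenation equivalence: $\sigma_j g_j\sigma_{j-1}$ may be replaced by the usual concatenation of $\sigma_{j-1}$ and $\sigma_j$ if $g_j$ is a unit; - deformations: continuous families of $G$-paths of the same order with fixed end points. Let $\Pi_1(G,x_0)$ be the group of $G$-homotopy classes of $G$-loops at $x_0$. Let $\omega$ be a smooth closed $1$-form on $M$ that is basic ($s^*\omega=t^*\omega$), let $\xi$ be its basic cohomology class, and put $\int_\sigma\omega=\sum_{k=0}^n\int_{\sigma_k}\omega$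 for a $G$-path $\sigma$. This depends only on the $G$-homotopy class of $\sigma$, and the homomorphism $\Pi_1(G,x_0)\to\mathbb R$, $[\sigma]\mapsto\int_\sigma\omega$, is the period homomorphism of $\xi$. Let $p:M_\xi\to M$ be a covering space over $G$ corresponding to the kernel of the period homomorphism. That is, $p$ is a (smooth) covering map together with a right $G$-action on $M_\xi$ along $p$ ($e\cdot g$ is defined if $p(e)=t(g)$, and $p(e\cdot g)=s(g)$), the action groupoid $M_\xi\rtimes G\rightrightarrows M_\xi$ (with arrows $(e,g):e\cdot g\to e$) is $(M_\xi\rtimes G)$-connected, and for a base point $e_0\in M_\xi$ with $x_0=p(e_0)$ the image $p_*\Pi_1(M_\xi\rtimes G,e_0)$ equals the kernel of the period homomorphism $\Pi_1(G,x_0)\to\mathbb R$. Here $p_*$ is induced by the groupoid morphism $(e,g)\mapsto g$ covering $p$. Let $f:M_\xi\to\mathbb R$ be a basic primitive of $p^*\omega$: a smooth function with $df=p^*\omega$ and $f(e\cdot g)=f(e)$ whenever $e\cdot g$ is defined. Let $\Gamma^G(M_\xi)$ be the set of equivariant covering transformations, i.e. diffeomorphisms $\varphi$ of $M_\xi$ with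 $p\circ\varphi=p$ and $\varphi(e\cdot g)=\varphi(e)\cdot g$. For $\varphi\in\Gamma^G(M_\xi)$ set $$\alpha_\xi(\varphi)=\int_{p_*\tilde\sigma}\omega ,$$ where $\tilde\sigma$ is an $(M_\xi\rtimes G)$-path from some $x\in M_\xi$ to $\varphi(x)$, so that $p_*\tilde\sigma$ is a $G$-loop at $p(x)$. Then $\alpha_\xi(\varphi)$ depends neither on $x$ nor on $\tilde\sigma$, and $$f(\varphi(x))=f(x)+\alpha_\xi(\varphi)\qquad\text{for all } x\in M_\xi \text{ and } \varphi\in\Gamma^G(M_\xi).$$ -/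

import Mathlib

open scoped Manifold ContDiff

noncomputable section

/-- A topological groupoid with space of arrows `G` and space of objects `M`.
The product `mul h g` ("first `g`, then `h`") is defined when `src h = tgt g`. -/
structure TopGroupoid (G M : Type*) [TopologicalSpace G] [TopologicalSpace M] where
  src : G → M
  tgt : G → M
  unit : M → G
  inv : G → G
  mul : (h g : G) → src h = tgt g → G
  src_unit : ∀ x, src (unit x) = x
  tgt_unit : ∀ x, tgt (unit x) = x
  src_inv : ∀ g, src (inv g) = tgt g
  tgt_inv : ∀ g, tgt (inv g) = src g
  src_mul : ∀ h g H, src (mul h g H) = src g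
  tgt_mul : ∀ h g H, tgt (mul h g H) = tgt h
  mul_assoc : ∀ k h g (H₁ : src k = tgt h) (H₂ : src h = tgt g),
    mul (mul k h H₁) g ((src_mul k h H₁).trans H₂) =
      mul k (mul h g H₂) (H₁.trans (tgt_mul h g H₂).symm)
  mul_unit : ∀ g, mul g (unit (src g)) (tgt_unit _).symm = g
  unit_mul : ∀ g, mul (unit (tgt g)) g (src_unit _) = g
  mul_inv : ∀ g, mul g (inv g) (tgt_inv g).symm = unit (tgt g)
  inv_mul : ∀ g, mul (inv g) g (src_inv g) = unit (src g)
  continuous_src : Continuous src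
  continuous_tgt : Continuous tgt
  continuous_unit : Continuous unit
  continuous_inv : Continuous inv
  continuous_mul : Continuous
    (fun q : {q : G × G // src q.1 = tgt q.2} => mul q.1.1 q.1.2 q.2)

open Classical in
/-- A Lie groupoid `G ⇉ M`: the arrows and the objects form smooth manifolds, all structure maps
are smooth, and the source and target maps are submersions.  Smoothness of the product refers to
the submanifold of composable pairs of `G × G`; the value of the function below outside that
submanifold is irrelevant. -/
structure LieGroupoid (EM EG : Type*) [NormedAddCommGroup EM] [NormedSpace ℝ EM]
    [NormedAddCommGroup EG] [NormedSpace ℝ EG] (G M : Type*)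
    [TopologicalSpace G] [ChartedSpace EG G] [TopologicalSpace M] [ChartedSpace EM M]
    extends TopGroupoid G M where
  contMDiff_src : ContMDiff 𝓘(ℝ, EG) 𝓘(ℝ, EM) ∞ src
  contMDiff_tgt : ContMDiff 𝓘(ℝ, EG) 𝓘(ℝ, EM) ∞ tgt
  contMDiff_unit : ContMDiff 𝓘(ℝ, EM) 𝓘(ℝ, EG) ∞ unit
  contMDiff_inv : ContMDiff 𝓘(ℝ, EG) 𝓘(ℝ, EG) ∞ inv
  contMDiffOn_mul : ContMDiffOn (𝓘(ℝ, EG).prod 𝓘(ℝ, EG)) 𝓘(ℝ, EG) ∞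
    (fun q : G × G => if H : src q.1 = tgt q.2 then mul q.1 q.2 H else q.1)
    {q : G × G | src q.1 = tgt q.2}
  submersion_src : ∀ g, Function.Surjective (mfderiv 𝓘(ℝ, EG) 𝓘(ℝ, EM) src g)
  submersion_tgt : ∀ g, Function.Surjective (mfderiv 𝓘(ℝ, EG) 𝓘(ℝ, EM) tgt g)

section Paths

variable (EM : Type*) [NormedAddCommGroup EM] [NormedSpace ℝ EM]
  {M : Type*} [TopologicalSpace M] [ChartedSpace EM M]

/-- A continuous path is piecewise smooth if, away from finitely many break points, it is smooth
on closed subintervals (up to their end points). -/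
def IsPiecewiseSmooth {x y : M} (γ : Path x y) : Prop :=
  ∃ S : Finset ℝ, ∀ a b : ℝ, 0 ≤ a → b ≤ 1 → (∀ s ∈ S, s ∉ Set.Ioo a b) →
    ContMDiffOn 𝓘(ℝ, ℝ) 𝓘(ℝ, EM) ∞ γ.extend (Set.Icc a b)

/-- Piecewise smooth paths `[0,1] → M` from `x` to `y`. -/
structure PSPath (x y : M) where
  toPath : Path x y
  piecewiseSmooth : IsPiecewiseSmooth EM toPath

variable {EM}

/-- The constant path. -/
def PSPath.refl (x : M) : PSPath EM x x where
  toPath := Path.refl x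
  piecewiseSmooth := by
    refine ⟨∅, fun a b _ _ _ => ?_⟩
    exact contMDiffOn_const

/-- The standard concatenation (first `γ`, then `γ'`). -/
def PSPath.trans {x y z : M} (γ : PSPath EM x y) (γ' : PSPath EM y z) : PSPath EM x z where
  toPath := γ.toPath.trans γ'.toPath
  piecewiseSmooth := by
    classical
    obtain ⟨S, hS⟩ := γ.piecewiseSmooth
    obtain ⟨S', hS'⟩ := γ'.piecewiseSmooth
    refine ⟨insert (1 / 2) (S.image (fun s => s / 2) ∪ S'.image (fun s => (s + 1) / 2)),
      fun a b ha hb hab => ?_⟩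
    by_cases h1 : b ≤ 1 / 2
    · have key : ContMDiffOn 𝓘(ℝ, ℝ) 𝓘(ℝ, EM) ∞ γ.toPath.extend (Set.Icc (2 * a) (2 * b)) := by
        refine hS _ _ (by linarith) (by linarith) fun s hs hs' => ?_
        exact hab (s / 2) (by simp; grind) ⟨by linarith [hs'.1], by linarith [hs'.2]⟩
      have hlin : ContMDiff 𝓘(ℝ, ℝ) 𝓘(ℝ, ℝ) ∞ (fun t : ℝ => 2 * t) :=
        (contDiff_const.mul contDiff_id).contMDiff
      refine (key.comp hlin.contMDiffOn (s := Set.Icc a b) fun t ht =>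
        ⟨by linarith [ht.1], by linarith [ht.2]⟩).congr fun t ht => ?_
      simpa using Path.extend_trans_of_le_half γ.toPath γ'.toPath (by linarith [ht.2])
    · by_cases h2 : 1 / 2 ≤ a
      · have key : ContMDiffOn 𝓘(ℝ, ℝ) 𝓘(ℝ, EM) ∞ γ'.toPath.extend
            (Set.Icc (2 * a - 1) (2 * b - 1)) := by
          refine hS' _ _ (by linarith) (by linarith) fun s hs hs' => ?_
          exact hab ((s + 1) / 2) (by simp; grind) ⟨by linarith [hs'.1], by linarith [hs'.2]⟩
        have hlin : ContMDiff 𝓘(ℝ, ℝ) 𝓘(ℝ, ℝ) ∞ (fun t : ℝ => 2 * t - 1) :=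
          ((contDiff_const.mul contDiff_id).sub contDiff_const).contMDiff
        refine (key.comp hlin.contMDiffOn (s := Set.Icc a b) fun t ht =>
          ⟨by linarith [ht.1], by linarith [ht.2]⟩).congr fun t ht => ?_
        simpa using Path.extend_trans_of_half_le γ.toPath γ'.toPath (by linarith [ht.1])
      · exact absurd ⟨not_le.1 h2, not_le.1 h1⟩ (hab (1 / 2) (by simp))

/-- The image of a piecewise smooth path under a smooth map. -/
def PSPath.map {N : Type*} [TopologicalSpace N] [ChartedSpace EM N] {x y : N}
    (γ : PSPath EM x y) {f : N → M} (hf : ContMDiff 𝓘(ℝ, EM) 𝓘(ℝ, EM) ∞ f) :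
    PSPath EM (f x) (f y) where
  toPath := γ.toPath.map hf.continuous
  piecewiseSmooth := by
    obtain ⟨S, hS⟩ := γ.piecewiseSmooth
    exact ⟨S, fun a b ha hb hab => hf.comp_contMDiffOn (hS a b ha hb hab)⟩

end Paths

section GPaths

variable {EM : Type*} [NormedAddCommGroup EM] [NormedSpace ℝ EM]
  {G M : Type*} [TopologicalSpace G] [TopologicalSpace M] [ChartedSpace EM M]

/-- A `G`-path `σₙ gₙ σₙ₋₁ ⋯ σ₁ g₁ σ₀` from `x` to `y`: piecewise smooth paths `σⱼ` in `M` and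
arrows `gⱼ` from the end point of `σⱼ₋₁` to the starting point of `σⱼ`. -/
inductive GPath (EM : Type*) [NormedAddCommGroup EM] [NormedSpace ℝ EM]
    {G M : Type*} [TopologicalSpace G] [TopologicalSpace M] [ChartedSpace EM M]
    (Γ : TopGroupoid G M) (x : M) : M → Type _
  | single {y : M} (γ : PSPath EM x y) : GPath EM Γ x y
  | snoc {y w z : M} (σ : GPath EM Γ x y) (g : G) (hs : Γ.src g = y) (ht : Γ.tgt g = w)
      (γ : PSPath EM w z) : GPath EM Γ x z

/-- `G`-connectedness: any two points are joined by a `G`-path. -/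
def TopGroupoid.IsGConnected (EM : Type*) [NormedAddCommGroup EM] [NormedSpace ℝ EM]
    {G M : Type*} [TopologicalSpace G] [TopologicalSpace M] [ChartedSpace EM M]
    (Γ : TopGroupoid G M) : Prop :=
  ∀ x y : M, Nonempty (GPath EM Γ x y)

variable (Γ : TopGroupoid G M)

/-- A continuous family, parametrized by `τ ∈ [0,1]`, of `G`-paths
`Dₙ(τ,·) dₙ(τ) ⋯ d₁(τ) D₀(τ,·)` of a fixed order that start at `x` and end at `z τ`. -/
inductive IsDeformation (x : M) :
    (z : unitInterval → M) → ((τ : unitInterval) → GPath EM Γ x (z τ)) → Prop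
  | single {z : unitInterval → M} (D : (τ : unitInterval) → PSPath EM x (z τ))
      (hD : Continuous fun q : unitInterval × unitInterval => (D q.1).toPath q.2) :
      IsDeformation x z (fun τ => GPath.single (D τ))
  | snoc {y w z : unitInterval → M} (F : (τ : unitInterval) → GPath EM Γ x (y τ))
      (hF : IsDeformation x y F) (d : unitInterval → G) (hd : Continuous d)
      (hs : ∀ τ, Γ.src (d τ) = y τ) (ht : ∀ τ, Γ.tgt (d τ) = w τ)
      (D : (τ : unitInterval) → PSPath EM (w τ) (z τ))
      (hD : Continuous fun q : unitInterval × unitInterval => (D q.1).toPath q.2) :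
      IsDeformation x z (fun τ => GPath.snoc (F τ) (d τ) (hs τ) (ht τ) (D τ))

/-- The elementary moves that generate `G`-homotopy: multiplication equivalence, concatenation
equivalence (at any position of a `G`-path), and deformations with fixed end points. -/
inductive GHomotopyStep (x : M) :
    {y : M} → GPath EM Γ x y → GPath EM Γ x y → Prop
  | mul {y w v z : M} (σ : GPath EM Γ x y) (g h : G) (hs : Γ.src g = y) (ht : Γ.tgt g = w)
      (hs' : Γ.src h = w) (ht' : Γ.tgt h = v) (γ : PSPath EM v z) :
      GHomotopyStep x
        (GPath.snoc (GPath.snoc σ g hs ht (PSPath.refl w)) h hs' ht' γ)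
        (GPath.snoc σ (Γ.mul h g (hs'.trans ht.symm))
          ((Γ.src_mul _ _ _).trans hs) ((Γ.tgt_mul _ _ _).trans ht') γ)
  | concat_single {y z : M} (γ : PSPath EM x y) (γ' : PSPath EM y z) :
      GHomotopyStep x
        (GPath.snoc (GPath.single γ) (Γ.unit y) (Γ.src_unit y) (Γ.tgt_unit y) γ')
        (GPath.single (γ.trans γ'))
  | concat_snoc {y w v z : M} (σ : GPath EM Γ x y) (g : G) (hs : Γ.src g = y)
      (ht : Γ.tgt g = w) (γ : PSPath EM w v) (γ' : PSPath EM v z) :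
      GHomotopyStep x
        (GPath.snoc (GPath.snoc σ g hs ht γ) (Γ.unit v) (Γ.src_unit v) (Γ.tgt_unit v) γ')
        (GPath.snoc σ g hs ht (γ.trans γ'))
  | deform {y : M} (F : unitInterval → GPath EM Γ x y)
      (hF : IsDeformation Γ x (fun _ => y) F) : GHomotopyStep x (F 0) (F 1)
  | snoc_congr {y w z : M} (σ σ' : GPath EM Γ x y) (hσ : GHomotopyStep x σ σ') (g : G)
      (hs : Γ.src g = y) (ht : Γ.tgt g = w) (γ : PSPath EM w z) :
      GHomotopyStep x (GPath.snoc σ g hs ht γ) (GPath.snoc σ' g hs ht γ)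

/-- `G`-homotopy of `G`-paths with the same end points, as an equivalence relation. -/
def gHomotopySetoid (EM : Type*) [NormedAddCommGroup EM] [NormedSpace ℝ EM]
    {G M : Type*} [TopologicalSpace G] [TopologicalSpace M] [ChartedSpace EM M]
    (Γ : TopGroupoid G M) (x y : M) : Setoid (GPath EM Γ x y) :=
  Relation.EqvGen.setoid (GHomotopyStep Γ x)

/-- (The underlying set of) the fundamental group `Π₁(G, x₀)`: the `G`-homotopy classes of
`G`-loops at `x₀`. -/
def FundGroup (EM : Type*) [NormedAddCommGroup EM] [NormedSpace ℝ EM]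
    {G M : Type*} [TopologicalSpace G] [TopologicalSpace M] [ChartedSpace EM M]
    (Γ : TopGroupoid G M) (x₀ : M) : Type _ :=
  Quotient (gHomotopySetoid EM Γ x₀ x₀)

/-- A morphism of groupoids, continuous on arrows and smooth on objects. -/
structure GroupoidMor (EM : Type*) [NormedAddCommGroup EM] [NormedSpace ℝ EM]
    {A E G M : Type*} [TopologicalSpace A] [TopologicalSpace E] [ChartedSpace EM E]
    [TopologicalSpace G] [TopologicalSpace M] [ChartedSpace EM M]
    (Δ : TopGroupoid A E) (Γ : TopGroupoid G M) where
  arr : A → G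
  obj : E → M
  continuous_arr : Continuous arr
  contMDiff_obj : ContMDiff 𝓘(ℝ, EM) 𝓘(ℝ, EM) ∞ obj
  src_arr : ∀ a, Γ.src (arr a) = obj (Δ.src a)
  tgt_arr : ∀ a, Γ.tgt (arr a) = obj (Δ.tgt a)
  arr_unit : ∀ e, arr (Δ.unit e) = Γ.unit (obj e)
  arr_mul : ∀ b a (H : Δ.src b = Δ.tgt a), arr (Δ.mul b a H) =
    Γ.mul (arr b) (arr a) (((src_arr b).trans (congrArg obj H)).trans (tgt_arr a).symm)

variable {A E : Type*} [TopologicalSpace A] [TopologicalSpace E] [ChartedSpace EM E]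
  {Δ : TopGroupoid A E} {Γ}

/-- The push-forward `P_* σ` of a `G`-path. -/
def GPath.map (P : GroupoidMor EM Δ Γ) {x : E} :
    {y : E} → GPath EM Δ x y → GPath EM Γ (P.obj x) (P.obj y)
  | _, .single γ => .single (γ.map P.contMDiff_obj)
  | _, .snoc σ g hs ht γ => .snoc (GPath.map P σ) (P.arr g)
      ((P.src_arr g).trans (congrArg P.obj hs)) ((P.tgt_arr g).trans (congrArg P.obj ht))
      (γ.map P.contMDiff_obj)

theorem PSPath.map_refl {N : Type*} [TopologicalSpace N] [ChartedSpace EM N] (x : N)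
    {f : N → M} (hf : ContMDiff 𝓘(ℝ, EM) 𝓘(ℝ, EM) ∞ f) :
    (PSPath.refl x).map hf = PSPath.refl (EM := EM) (f x) := by
  simp only [PSPath.map, PSPath.refl]
  congr 1

theorem PSPath.map_trans {N : Type*} [TopologicalSpace N] [ChartedSpace EM N] {x y z : N}
    (γ : PSPath EM x y) (γ' : PSPath EM y z)
    {f : N → M} (hf : ContMDiff 𝓘(ℝ, EM) 𝓘(ℝ, EM) ∞ f) :
    (γ.trans γ').map hf = (γ.map hf).trans (γ'.map hf) := by
  simp only [PSPath.map, PSPath.trans, Path.map_trans]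

theorem IsDeformation.map (P : GroupoidMor EM Δ Γ) {x : E} {z : unitInterval → E}
    {F : (τ : unitInterval) → GPath EM Δ x (z τ)} (hF : IsDeformation Δ x z F) :
    IsDeformation Γ (P.obj x) (fun τ => P.obj (z τ)) (fun τ => (F τ).map P) := by
  induction hF with
  | single D hD =>
    exact .single (fun τ => (D τ).map P.contMDiff_obj) (P.contMDiff_obj.continuous.comp hD)
  | snoc F hF d hd hs ht D hD ih =>
    exact .snoc _ ih (fun τ => P.arr (d τ)) (P.continuous_arr.comp hd) _ _
      (fun τ => (D τ).map P.contMDiff_obj) (P.contMDiff_obj.continuous.comp hD)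

theorem GHomotopyStep.map (P : GroupoidMor EM Δ Γ) {x y : E} {σ σ' : GPath EM Δ x y}
    (h : GHomotopyStep Δ x σ σ') : GHomotopyStep Γ (P.obj x) (σ.map P) (σ'.map P) := by
  induction h with
  | mul σ g h hs ht hs' ht' γ =>
    simp only [GPath.map, PSPath.map_refl, P.arr_mul]
    exact .mul _ _ _ _ _ _ _ _
  | concat_single γ γ' =>
    simp only [GPath.map, PSPath.map_trans, P.arr_unit]
    exact .concat_single _ _
  | concat_snoc σ g hs ht γ γ' =>
    simp only [GPath.map, PSPath.map_trans, P.arr_unit]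
    exact .concat_snoc _ _ _ _ _ _
  | deform F hF => exact .deform (fun τ => (F τ).map P) (hF.map P)
  | snoc_congr σ σ' hσ g hs ht γ ih => exact .snoc_congr _ _ ih _ _ _ _

/-- The map `P_* : Π₁(Δ, e₀) → Π₁(Γ, P(e₀))` induced by a groupoid morphism. -/
def FundGroup.map (P : GroupoidMor EM Δ Γ) (e₀ : E) :
    FundGroup EM Δ e₀ → FundGroup EM Γ (P.obj e₀) :=
  Quotient.map (sa := gHomotopySetoid EM Δ e₀ e₀)
    (sb := gHomotopySetoid EM Γ (P.obj e₀) (P.obj e₀)) (GPath.map P) (by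
      intro σ σ' h
      induction h with
      | rel _ _ h => exact .rel _ _ (h.map P)
      | refl _ => exact .refl _
      | symm _ _ _ ih => exact .symm _ _ ih
      | trans _ _ _ _ _ ih₁ ih₂ => exact .trans _ _ _ ih₁ ih₂)

end GPaths

section Forms

variable {EM : Type*} [NormedAddCommGroup EM] [NormedSpace ℝ EM]
  {EG : Type*} [NormedAddCommGroup EG] [NormedSpace ℝ EG]
  {G M : Type*} [TopologicalSpace G] [ChartedSpace EG G] [TopologicalSpace M] [ChartedSpace EM M]

/-- Not necessarily continuous `1`-forms on `M`. -/
abbrev OneForm (EM : Type*) [NormedAddCommGroup EM] [NormedSpace ℝ EM]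
    (M : Type*) [TopologicalSpace M] [ChartedSpace EM M] : Type _ :=
  (x : M) → (TangentSpace 𝓘(ℝ, EM) x →L[ℝ] ℝ)

/-- The pull-back `p^* η`. -/
def OneForm.pullback {EN : Type*} [NormedAddCommGroup EN] [NormedSpace ℝ EN]
    {N : Type*} [TopologicalSpace N] [ChartedSpace EN N]
    (p : N → M) (η : OneForm EM M) : OneForm EN N :=
  fun e => (η (p e)).comp (mfderiv 𝓘(ℝ, EN) 𝓘(ℝ, EM) p e)

/-- The coordinate expression of a `1`-form in the preferred chart at `x₀`. -/
def OneForm.inChart (η : OneForm EM M) (x₀ : M) : EM → (EM →L[ℝ] ℝ) :=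
  OneForm.pullback (EN := EM) (extChartAt 𝓘(ℝ, EM) x₀).symm η

/-- Smooth closed basic `1`-forms: `η` is smooth, `dη = 0` (in every chart, the matrix of partial
derivatives of the coefficients is symmetric), and `s^* η = t^* η`. -/
structure LieGroupoid.IsClosedBasic (Γ : LieGroupoid EM EG G M) (η : OneForm EM M) : Prop where
  smooth : ∀ x₀ : M, ContDiffOn ℝ ∞ (η.inChart x₀) (extChartAt 𝓘(ℝ, EM) x₀).target
  closed : ∀ x₀ : M, ∀ y ∈ (extChartAt 𝓘(ℝ, EM) x₀).target, ∀ v w : EM,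
    fderiv ℝ (η.inChart x₀) y v w = fderiv ℝ (η.inChart x₀) y w v
  basic : OneForm.pullback (EN := EG) Γ.src η = OneForm.pullback (EN := EG) Γ.tgt η

/-- The line integral `∫_γ η`. -/
def PSPath.integral (η : OneForm EM M) {x y : M} (γ : PSPath EM x y) : ℝ :=
  ∫ t in (0 : ℝ)..1,
    η (γ.toPath.extend t) (mfderiv 𝓘(ℝ, ℝ) 𝓘(ℝ, EM) γ.toPath.extend t (1 : ℝ))

/-- The `G`-path integral `∫_σ η = ∑ₖ ∫_{σₖ} η`. -/
def GPath.integral {G : Type*} [TopologicalSpace G] {Γ : TopGroupoid G M} (η : OneForm EM M)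
    {x : M} : {y : M} → GPath EM Γ x y → ℝ
  | _, .single γ => γ.integral η
  | _, .snoc σ _ _ _ γ => GPath.integral η σ + γ.integral η

/-- The kernel of the period homomorphism `Π₁(G, x₀) → ℝ`, `[σ] ↦ ∫_σ η`: the classes of the
`G`-loops with period zero.  (For closed basic `η` the period depends only on the class.) -/
def periodKernel {G : Type*} [TopologicalSpace G] (Γ : TopGroupoid G M) (η : OneForm EM M)
    (x₀ : M) : Set (FundGroup EM Γ x₀) :=
  {c | ∃ σ : GPath EM Γ x₀ x₀,
    Quotient.mk (gHomotopySetoid EM Γ x₀ x₀) σ = c ∧ σ.integral η = 0}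

end Forms

section Coverings

variable {EM : Type*} [NormedAddCommGroup EM] [NormedSpace ℝ EM]
  {G M : Type*} [TopologicalSpace G] [TopologicalSpace M] [ChartedSpace EM M]

/-- A covering space `p : E → M` over a groupoid `G ⇉ M`: a smooth covering map with a right
`G`-action along `p`, where `e · g` is defined when `p e = t g`.  Because `p` is a local
diffeomorphism and `p (e · g) = s g`, a continuous action is automatically smooth. -/
structure CoveringOver (Γ : TopGroupoid G M) (EM : Type*) [NormedAddCommGroup EM]
    [NormedSpace ℝ EM] [ChartedSpace EM M]
    (E : Type*) [TopologicalSpace E] [ChartedSpace EM E] where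
  p : E → M
  isCoveringMap : IsCoveringMap p
  surjective : Function.Surjective p
  isLocalDiffeomorph : IsLocalDiffeomorph 𝓘(ℝ, EM) 𝓘(ℝ, EM) ∞ p
  act : (e : E) → (g : G) → p e = Γ.tgt g → E
  p_act : ∀ e g H, p (act e g H) = Γ.src g
  act_unit : ∀ e, act e (Γ.unit (p e)) (Γ.tgt_unit _).symm = e
  act_act : ∀ e g h (H : p e = Γ.tgt g) (H' : Γ.src g = Γ.tgt h),
    act (act e g H) h ((p_act e g H).trans H') =
      act e (Γ.mul g h H') (H.trans (Γ.tgt_mul g h H').symm)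
  continuous_act : Continuous
    (fun q : {q : E × G // p q.1 = Γ.tgt q.2} => act q.1.1 q.1.2 q.2)

namespace CoveringOver

variable {Γ : TopGroupoid G M} {E : Type*} [TopologicalSpace E] [ChartedSpace EM E]
  (C : CoveringOver Γ EM E)

/-- The arrows `(e, g) : e · g → e` of the action groupoid. -/
abbrev Arrow : Type _ := {q : E × G // C.p q.1 = Γ.tgt q.2}

theorem act_congr {e e' : E} {g g' : G} (he : e = e') (hg : g = g') (H : C.p e = Γ.tgt g) :
    C.act e g H = C.act e' g' (by rw [← he, ← hg]; exact H) := by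
  subst he hg; rfl

theorem act_unit' (e : E) (x : M) (H : C.p e = Γ.tgt (Γ.unit x)) :
    C.act e (Γ.unit x) H = e := by
  have hx : x = C.p e := (H.trans (Γ.tgt_unit x)).symm
  subst hx
  exact C.act_unit e

/-- The action groupoid `E ⋊ G ⇉ E`: source `(e, g) ↦ e · g`, target `(e, g) ↦ e`, product
`(e, g) (e · g, h) = (e, g h)`. -/
def actionGroupoid : TopGroupoid C.Arrow E where
  src a := C.act a.1.1 a.1.2 a.2
  tgt a := a.1.1
  unit e := ⟨(e, Γ.unit (C.p e)), (Γ.tgt_unit _).symm⟩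
  inv a := ⟨(C.act a.1.1 a.1.2 a.2, Γ.inv a.1.2), (C.p_act _ _ _).trans (Γ.tgt_inv _).symm⟩
  mul b a H := ⟨(b.1.1, Γ.mul b.1.2 a.1.2
      ((C.p_act _ _ b.2).symm.trans ((congrArg C.p H).trans a.2))),
    b.2.trans (Γ.tgt_mul _ _ _).symm⟩
  src_unit e := C.act_unit e
  tgt_unit e := rfl
  src_inv a := by
    rw [C.act_act _ _ _ a.2 (Γ.tgt_inv _).symm, C.act_congr rfl (Γ.mul_inv _), C.act_unit']
  tgt_inv a := rfl
  src_mul b a H := by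
    rw [← C.act_act _ _ _ b.2]
    exact C.act_congr H rfl _
  tgt_mul b a H := rfl
  mul_assoc k h g H₁ H₂ := by
    apply Subtype.ext
    exact Prod.ext rfl (Γ.mul_assoc _ _ _ _ _)
  mul_unit a := by
    apply Subtype.ext
    refine Prod.ext rfl ?_
    have key : ∀ x (hx : Γ.src a.1.2 = Γ.tgt (Γ.unit x)), Γ.mul a.1.2 (Γ.unit x) hx = a.1.2 := by
      intro x hx
      have : x = Γ.src a.1.2 := (hx.trans (Γ.tgt_unit x)).symm
      subst this
      exact Γ.mul_unit _
    exact key _ _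
  unit_mul a := by
    apply Subtype.ext
    refine Prod.ext rfl ?_
    have key : ∀ x (hx : Γ.src (Γ.unit x) = Γ.tgt a.1.2), Γ.mul (Γ.unit x) a.1.2 hx = a.1.2 := by
      intro x hx
      have : x = Γ.tgt a.1.2 := (Γ.src_unit x).symm.trans hx
      subst this
      exact Γ.unit_mul _
    exact key _ _
  mul_inv a := by
    apply Subtype.ext
    exact Prod.ext rfl ((Γ.mul_inv _).trans (congrArg Γ.unit a.2.symm))
  inv_mul a := by
    apply Subtype.ext
    exact Prod.ext rfl ((Γ.inv_mul _).trans (congrArg Γ.unit (C.p_act _ _ _).symm))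
  continuous_src := C.continuous_act
  continuous_tgt := continuous_fst.comp continuous_subtype_val
  continuous_unit := Continuous.subtype_mk (continuous_id.prodMk
    (Γ.continuous_unit.comp C.isCoveringMap.continuous)) _
  continuous_inv := Continuous.subtype_mk (C.continuous_act.prodMk
    (Γ.continuous_inv.comp (continuous_snd.comp continuous_subtype_val))) _
  continuous_mul := by
    refine Continuous.subtype_mk (Continuous.prodMk (by fun_prop) ?_) _
    have h : Continuous fun q : {q : C.Arrow × C.Arrow //
        C.act q.1.1.1 q.1.1.2 q.1.2 = q.2.1.1} => (q.1.1.1.2, q.1.2.1.2) := by fun_prop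
    exact Γ.continuous_mul.comp (h.subtype_mk fun q =>
      (C.p_act _ _ q.1.1.2).symm.trans ((congrArg C.p q.2).trans q.1.2.2))

/-- The morphism `p : E ⋊ G → G`, `(e, g) ↦ g`, covering `p : E → M`. -/
def proj : GroupoidMor EM C.actionGroupoid Γ where
  arr a := a.1.2
  obj := C.p
  continuous_arr := continuous_snd.comp continuous_subtype_val
  contMDiff_obj := C.isLocalDiffeomorph.contMDiff
  src_arr _ := (C.p_act _ _ _).symm
  tgt_arr a := a.2.symm
  arr_unit _ := rfl
  arr_mul _ _ _ := rfl

/-- The equivariant automorphisms (deck transformations) of a covering space over `G`. -/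
structure Deck where
  toDiffeo : Diffeomorph 𝓘(ℝ, EM) 𝓘(ℝ, EM) E E ∞
  p_apply : ∀ e, C.p (toDiffeo e) = C.p e
  equivariant : ∀ e g (H : C.p e = Γ.tgt g),
    toDiffeo (C.act e g H) = C.act (toDiffeo e) g ((p_apply e).trans H)

/-- `C` corresponds to the kernel of the period homomorphism: `p_*(Π₁(E ⋊ G, e₀))` is that
kernel in `Π₁(G, p(e₀))`. -/
def CorrespondsToPeriodKernel (η : OneForm EM M) (e₀ : E) : Prop :=
  Set.range (FundGroup.map C.proj e₀) = periodKernel Γ η (C.p e₀)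

/-- `f` is a basic primitive of `p^* η`: a smooth function with `df = p^* η` and
`f (s a) = f (t a)` for all arrows `a` of the action groupoid. -/
structure IsBasicPrimitive (η : OneForm EM M) (f : E → ℝ) : Prop where
  smooth : ContMDiff 𝓘(ℝ, EM) 𝓘(ℝ, ℝ) ∞ f
  basic : ∀ a : C.Arrow, f (C.actionGroupoid.src a) = f (C.actionGroupoid.tgt a)
  primitive : ∀ (e : E) (v : TangentSpace 𝓘(ℝ, EM) e),
    mfderiv 𝓘(ℝ, EM) 𝓘(ℝ, ℝ) f e v = OneForm.pullback (EN := EM) C.p η e v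

/-- `α_ξ(φ) = ∫_{p_* σ̃} η` for a chosen `(E ⋊ G)`-path `σ̃` from the base point `e₀` to
`φ(e₀)`. -/
def alpha (hC : C.actionGroupoid.IsGConnected EM) (η : OneForm EM M) (e₀ : E) (φ : C.Deck) : ℝ :=
  ((hC e₀ (φ.toDiffeo e₀)).some.map C.proj).integral η

end CoveringOver

end Coverings

end

/-! ### Piecewise fundamental theorem of calculus on the line. -/

open MeasureTheory

/-! Everything rests on one formula: for an action-groupoid path `σ` from `x` to `y`, the integral
of `η` over its projection is `f y - f x`. On each path piece this is the fundamental theorem of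
calculus applied to `f ∘ γ`, because `df = p^* η`; across an arrow the integral gains nothing, and
neither does `f`, because `f` is invariant (`IsBasicPrimitive.integral_map_proj`).

Hence every candidate for `α(φ)` is an increment `f (φ x) - f x`, visibly independent of the path,
and what remains is independence of `x`. Since `p ∘ φ = p` and `φ` is equivariant, `f ∘ φ` is again
a basic primitive of `p^* η` (`IsBasicPrimitive.comp_deck`). Applying the formula to `f` and to `f ∘
φ` along one path from `x` to `y`, which exists by connectedness of the action groupoid, shows that
`f ∘ φ - f` is constant (`IsBasicPrimitive.sub_deck_eq`). -/

/-- The fundamental theorem of calculus for a function that is `C¹` on a closed interval up to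
its end points. -/
theorem ContDiffOn.intervalIntegrable_deriv_and_integral_eq_sub {g : ℝ → ℝ} {a b : ℝ}
    (hab : a ≤ b) (hg : ContDiffOn ℝ 1 g (Set.Icc a b)) :
    IntervalIntegrable (deriv g) volume a b ∧ ∫ t in a..b, deriv g t = g b - g a := by
  -- A one-point interval is not a set of unique differentiability, so it is treated apart.
  rcases hab.eq_or_lt with rfl | hlt
  · simp
  have hcont : ContinuousOn (derivWithin g (Set.Icc a b)) (Set.Icc a b) :=
    hg.continuousOn_derivWithin (uniqueDiffOn_Icc hlt) le_rfl
  have hint : IntervalIntegrable (derivWithin g (Set.Icc a b)) volume a b :=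
    ContinuousOn.intervalIntegrable (by rwa [Set.uIcc_of_le hab])
  have heq : Set.EqOn (derivWithin g (Set.Icc a b)) (deriv g) (Set.Ioo a b) := fun t ht =>
    derivWithin_of_mem_nhds (Icc_mem_nhds ht.1 ht.2)
  -- At the end points `g` is controlled from one side only and `deriv g` may be the default value
  -- `0`; these points are null, so integrability passes through the open interval.
  have hint' : IntervalIntegrable (deriv g) volume a b := by
    rw [intervalIntegrable_iff_integrableOn_Ioo_of_le hab] at hint ⊢
    exact hint.congr_fun heq measurableSet_Ioo
  refine ⟨hint', intervalIntegral.integral_eq_sub_of_hasDerivAt_of_le hab hg.continuousOn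
    (fun t ht => ?_) hint'⟩
  exact ((hg.differentiableOn one_ne_zero).differentiableAt
    (Icc_mem_nhds ht.1 ht.2)).hasDerivAt

/-- The fundamental theorem of calculus for piecewise smooth functions. -/
theorem intervalIntegrable_and_integral_eq_sub_of_piecewise {g h : ℝ → ℝ} (S : Finset ℝ)
    (hS : ∀ a b : ℝ, 0 ≤ a → a ≤ b → b ≤ 1 → (∀ s ∈ S, s ∉ Set.Ioo a b) →
      ContDiffOn ℝ 1 g (Set.Icc a b) ∧ Set.EqOn (deriv g) h (Set.Ioo a b))
    {a b : ℝ} (ha : 0 ≤ a) (hab : a ≤ b) (hb : b ≤ 1) :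
    IntervalIntegrable h volume a b ∧ ∫ t in a..b, h t = g b - g a := by
  classical
  -- Induction on the number of break points strictly inside `(a, b)`. Cutting at such an `s` lowers
  -- the count on both halves, since `s` lies in neither open half.
  induction hn : (S.filter (· ∈ Set.Ioo a b)).card using Nat.strong_induction_on
    generalizing a b with
  | _ n ih =>
    by_cases hne : ∃ s ∈ S, s ∈ Set.Ioo a b
    · obtain ⟨s, hs, hsab⟩ := hne
      have hl : (S.filter (· ∈ Set.Ioo a s)).card < n := by
        rw [← hn]
        refine Finset.card_lt_card (Finset.ssubset_iff_of_subset ?_ |>.2 ⟨s, ?_, ?_⟩)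
        · exact Finset.monotone_filter_right _ fun t _ ht => ⟨ht.1, ht.2.trans hsab.2⟩
        · exact Finset.mem_filter.2 ⟨hs, hsab⟩
        · simp
      have hr : (S.filter (· ∈ Set.Ioo s b)).card < n := by
        rw [← hn]
        refine Finset.card_lt_card (Finset.ssubset_iff_of_subset ?_ |>.2 ⟨s, ?_, ?_⟩)
        · exact Finset.monotone_filter_right _ fun t _ ht => ⟨hsab.1.trans ht.1, ht.2⟩
        · exact Finset.mem_filter.2 ⟨hs, hsab⟩
        · simp
      obtain ⟨i₁, e₁⟩ := ih _ hl ha hsab.1.le (hsab.2.le.trans hb) rfl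
      obtain ⟨i₂, e₂⟩ := ih _ hr (ha.trans hsab.1.le) hsab.2.le hb rfl
      refine ⟨i₁.trans i₂, ?_⟩
      rw [← intervalIntegral.integral_add_adjacent_intervals i₁ i₂, e₁, e₂]
      ring
    · push Not at hne
      obtain ⟨hg, hgh⟩ := hS a b ha hab hb hne
      obtain ⟨hi, he⟩ := hg.intervalIntegrable_deriv_and_integral_eq_sub hab
      -- `h` is known to equal `deriv g` only on the open interval, so both claims are moved to
      -- `Ioo`.
      constructor
      · rw [intervalIntegrable_iff_integrableOn_Ioo_of_le hab] at hi ⊢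
        exact hi.congr_fun hgh measurableSet_Ioo
      · rw [← he, intervalIntegral.integral_of_le hab, intervalIntegral.integral_of_le hab,
          integral_Ioc_eq_integral_Ioo, integral_Ioc_eq_integral_Ioo]
        exact setIntegral_congr_fun measurableSet_Ioo hgh.symm

/-! ### Line integrals, basic primitives and deck transformations. -/

section

variable {EM : Type*} [NormedAddCommGroup EM] [NormedSpace ℝ EM]
  {M : Type*} [TopologicalSpace M] [ChartedSpace EM M]
  {E : Type*} [TopologicalSpace E] [ChartedSpace EM E]

/-- If `f` is a primitive of `p^* η`, the integral of `η` over `p ∘ γ` is the increment of `f`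
along `γ`. -/
theorem PSPath.integral_map_eq_sub {η : OneForm EM M} {p : E → M}
    (hp : ContMDiff 𝓘(ℝ, EM) 𝓘(ℝ, EM) ∞ p) {f : E → ℝ} (hf : ContMDiff 𝓘(ℝ, EM) 𝓘(ℝ, ℝ) ∞ f)
    (hfp : ∀ (e : E) (v : TangentSpace 𝓘(ℝ, EM) e),
      mfderiv 𝓘(ℝ, EM) 𝓘(ℝ, ℝ) f e v = OneForm.pullback (EN := EM) p η e v)
    {x y : E} (γ : PSPath EM x y) : (γ.map hp).integral η = f y - f x := by
  have hne : (∞ : WithTop ℕ∞) ≠ 0 := by simp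
  obtain ⟨S, hS⟩ := γ.piecewiseSmooth
  have key := (intervalIntegrable_and_integral_eq_sub_of_piecewise
    (g := f ∘ γ.toPath.extend)
    (h := fun t => η ((p ∘ γ.toPath.extend) t)
      (mfderiv 𝓘(ℝ, ℝ) 𝓘(ℝ, EM) (p ∘ γ.toPath.extend) t (1 : ℝ))) S
    (fun a b ha _ hb hs => ⟨?_, fun t ht => ?_⟩) le_rfl zero_le_one le_rfl).2
  -- Extending the image path by constants is definitionally `p` composed with the extension of `γ`.
  · have hint : (γ.map hp).integral η = ∫ t in (0 : ℝ)..1, η ((p ∘ γ.toPath.extend) t)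
        (mfderiv 𝓘(ℝ, ℝ) 𝓘(ℝ, EM) (p ∘ γ.toPath.extend) t (1 : ℝ)) := rfl
    rw [hint, key]
    simp
  · exact (contMDiffOn_iff_contDiffOn.1
      (hf.comp_contMDiffOn (hS a b ha hb hs))).of_le (by exact_mod_cast le_top)
  · have hγ : MDifferentiableAt 𝓘(ℝ, ℝ) 𝓘(ℝ, EM) γ.toPath.extend t :=
      ((hS a b ha hb hs).contMDiffAt (Icc_mem_nhds ht.1 ht.2)).mdifferentiableAt hne
    -- Chain rule for `f ∘ γ` and for `p ∘ γ`: `(f ∘ γ)' = df(γ') = η(dp(γ')) = η((p ∘ γ)')`.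
    have h1 := mfderiv_comp t (hf.mdifferentiableAt hne) hγ
    have h2 := mfderiv_comp t (hp.mdifferentiableAt hne) hγ
    have h3 : deriv (f ∘ γ.toPath.extend) t =
        mfderiv 𝓘(ℝ, ℝ) 𝓘(ℝ, ℝ) (f ∘ γ.toPath.extend) t (1 : ℝ) := by
      rw [mfderiv_eq_fderiv]; rfl
    rw [h3, h1]
    exact (hfp _ _).trans (congrArg
      (fun L : ℝ →L[ℝ] EM => (η (p (γ.toPath.extend t)) : EM →L[ℝ] ℝ) (L 1)) h2.symm)

namespace CoveringOver

variable {G : Type*} [TopologicalSpace G] {Γ : TopGroupoid G M} {C : CoveringOver Γ EM E}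
  {η : OneForm EM M} {f : E → ℝ}

/-- The integral of `η` over the projection of an `(E ⋊ G)`-path is the increment of a basic
primitive along the path. -/
theorem IsBasicPrimitive.integral_map_proj (hf : C.IsBasicPrimitive η f) {x y : E}
    (σ : GPath EM C.actionGroupoid x y) : (σ.map C.proj).integral η = f y - f x := by
  induction σ with
  | single γ => exact γ.integral_map_eq_sub _ hf.smooth hf.primitive
  | snoc σ g hs ht γ ih =>
    have hγ := γ.integral_map_eq_sub C.proj.contMDiff_obj hf.smooth hf.primitive
    -- Invariance makes `f` agree at the two ends of the arrow, so the increments of `f` on either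
    -- side of it telescope.
    have hg := hf.basic g
    rw [hs, ht] at hg
    simp only [GPath.map, GPath.integral]
    rw [ih, hγ, hg]
    ring

/-- The composition of a basic primitive with an equivariant covering transformation is a basic
primitive of the same form. -/
theorem IsBasicPrimitive.comp_deck (hf : C.IsBasicPrimitive η f) (φ : C.Deck) :
    C.IsBasicPrimitive η (f ∘ φ.toDiffeo) where
  smooth := hf.smooth.comp φ.toDiffeo.contMDiff
  basic a := by
    -- The image arrow `(φ e, g)` has source `φ e · g`, which is `φ (e · g)` by equivariance.
    have h := hf.basic ⟨(φ.toDiffeo a.1.1, a.1.2), (φ.p_apply _).trans a.2⟩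
    exact (congrArg f (φ.equivariant a.1.1 a.1.2 a.2)).trans h
  primitive e v := by
    have hne : (∞ : WithTop ℕ∞) ≠ 0 := by simp
    have hφ := φ.toDiffeo.contMDiff.mdifferentiableAt hne (x := e)
    have hp : C.p ∘ φ.toDiffeo = C.p := funext φ.p_apply
    -- Writing `p` as `p ∘ φ` makes both sides factor through `dφ`; what is left is the primitive
    -- property of `f` at `φ e`, applied to `dφ(v)`.
    have hpull : OneForm.pullback (EN := EM) C.p η =
        OneForm.pullback (EN := EM) (C.p ∘ φ.toDiffeo) η := by rw [hp]
    rw [hpull, OneForm.pullback, mfderiv_comp e (hf.smooth.mdifferentiableAt hne) hφ,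
      mfderiv_comp e (C.isLocalDiffeomorph.contMDiff.mdifferentiableAt hne) hφ]
    exact hf.primitive _ _

/-- The increment `f (φ x) - f x` of a basic primitive under an equivariant covering
transformation does not depend on the point. -/
theorem IsBasicPrimitive.sub_deck_eq (hf : C.IsBasicPrimitive η f)
    (hC : C.actionGroupoid.IsGConnected EM) (φ : C.Deck) (x y : E) :
    f (φ.toDiffeo x) - f x = f (φ.toDiffeo y) - f y := by
  -- One integral is computed twice, with the primitives `f ∘ φ` and `f`, giving `f (φ y) - f (φ x)
  -- = f y - f x`.
  have h := ((hf.comp_deck φ).integral_map_proj (hC x y).some).symm.trans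
    (hf.integral_map_proj _)
  simp only [Function.comp_apply] at h
  linarith

end CoveringOver

end

/-! ### The translation formula. -/

theorem mainTheorem10
    {EM : Type*} [NormedAddCommGroup EM] [NormedSpace ℝ EM] [FiniteDimensional ℝ EM]
    {EG : Type*} [NormedAddCommGroup EG] [NormedSpace ℝ EG] [FiniteDimensional ℝ EG]
    {M : Type*} [TopologicalSpace M] [ChartedSpace EM M] [IsManifold 𝓘(ℝ, EM) ∞ M]
    {G : Type*} [TopologicalSpace G] [ChartedSpace EG G] [IsManifold 𝓘(ℝ, EG) ∞ G]
    (Γ : LieGroupoid EM EG G M) (hΓ : Γ.toTopGroupoid.IsGConnected EM)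
    (η : OneForm EM M) (hη : Γ.IsClosedBasic η)
    {E : Type*} [TopologicalSpace E] [ChartedSpace EM E] [IsManifold 𝓘(ℝ, EM) ∞ E]
    (C : CoveringOver Γ.toTopGroupoid EM E) (hC : C.actionGroupoid.IsGConnected EM)
    (e₀ : E) (hker : C.CorrespondsToPeriodKernel η e₀)
    (f : E → ℝ) (hf : C.IsBasicPrimitive η f) :
    (∀ (φ : C.Deck) (x : E) (σ : GPath EM C.actionGroupoid x (φ.toDiffeo x)),
      (σ.map C.proj).integral η = C.alpha hC η e₀ φ) ∧
    ∀ (x : E) (φ : C.Deck), f (φ.toDiffeo x) = f x + C.alpha hC η e₀ φ := by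
  refine ⟨fun φ x σ => ?_, fun x φ => ?_⟩
  -- Both integrals become increments of `f`, one based at `x` and one at `e₀`.
  · rw [CoveringOver.alpha, hf.integral_map_proj, hf.integral_map_proj]
    exact hf.sub_deck_eq hC φ x e₀
  · rw [CoveringOver.alpha, hf.integral_map_proj, ← hf.sub_deck_eq hC φ x e₀]
    ring
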